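/- **Theorem 2.** Let $N,d\in\mathbb N$ and let $Z_{i,t}$, $i=1,\dots,N$, $t=1,2,\dots$, be random vectors in $\mathbb R^d$, independent across all pairs $(i,t)$ and, for each $i$, identically distributed in $t$. Let $\Lambda_i(\lambda)=\log\mathbb E[e^{\lambda^\top Z_{i,t}}]$ and assume $\Lambda_i(\lambda)<+\infty$ for all $\lambda\in\mathbb R^d$ and all $i$; let $m_i=\mathbb E[Z_{i,t}]$. Let $A\in\mathbb R^{N\times N}$ be a (row-)stochastic matrix with $|\lambda_2(A)|<1$, where $\lambda_2(A)$ is the second largest eigenvalue in modulus, eigenvalues being counted with algebraic multiplicity (if $N=1$ this condition is void). Let $a\in\mathbb R^N$ be the left eigenvector of $A$ for the eigenvalue $1$, normalized so that $\sum_j a_j=1$. Let $X_{i,0}=0$ and, for $t\ge1$, $$X_{i,t}=\sum_{j=1}^N A_{ij}\Big(\frac{t-1}{t}X_{j,t-1}+\frac1t Z_{j,t}\Big),\qquad i=1,\dots,N.$$ Put $\widetilde\Lambda(\lambda)=\sum_{j=1}^N\Lambda_j(a_j\lambda)$ and $\widetilde I(x)=\sup_{\lambda\in\mathbb R^d}\big(x^\top\lambda-\widetilde\Lambda(\lambda)\big)$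 for $\lambda,x\in\mathbb R^d$. Then, for every $i=1,\dots,N$, the sequence $X_{i,t}$, $t=1,2,\dots$, satisfies the large deviations principle with rate function $\widetilde I$ (the same at every $i$, and dependent on $A$ only through $a$): $\widetilde I:\mathbb R^d\to[0,+\infty]$ is lower semicontinuous and, for every Borel set $D\subseteq\mathbb R^d$ with interior $D^{\mathrm o}$ and closure $\overline D$, $$-\inf_{x\in D^{\mathrm o}}\widetilde I(x)\le\liminf_{t\to\infty}\frac1t\log\mathbb P(X_{i,t}\in D)\le\limsup_{t\to\infty}\frac1t\log\mathbb P(X_{i,t}\in D)\le-\inf_{x\in\overline D}\widetilde I(x).$$ Moreover, for every $i$, $X_{i,t}\to\sum_{j=1}^N a_j m_j$ almost surely as $t\to\infty$. -/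

import Mathlib

open MeasureTheory ProbabilityTheory Filter Topology

/-- `ℝ^d` with the Euclidean norm and inner product. -/
abbrev Vec (d : ℕ) : Type := EuclideanSpace ℝ (Fin d)

/-- The states `X_{i,t}` of the consensus+innovations algorithm with weight matrices `W_t` and
observations `Z_{i,t}`, `t = 1, 2, …`: `X_{i,0} = 0` and, for `t ≥ 1`,
`X_{i,t} = ∑ j, [W_t]_{ij} ((t-1)/t X_{j,t-1} + 1/t Z_{j,t})`. -/
noncomputable def nodeState {Ω : Type*} {N d : ℕ}
    (W : ℕ+ → Ω → Matrix (Fin N) (Fin N) ℝ) (Z : Fin N → ℕ+ → Ω → Vec d) :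
    Fin N → ℕ → Ω → Vec d
  | _, 0 => fun _ => 0
  | i, t + 1 => fun ω =>
      ∑ j, W t.succPNat ω i j •
        (((t : ℝ) / ((t : ℝ) + 1)) • nodeState W Z j t ω
          + (1 / ((t : ℝ) + 1)) • Z j t.succPNat ω)

/-- The moduli of all complex eigenvalues of a real square matrix, counted with algebraic
multiplicity and listed in decreasing order. -/
noncomputable def eigenvalueModuli {N : ℕ} (A : Matrix (Fin N) (Fin N) ℝ) : List ℝ :=
  (((A.map (algebraMap ℝ ℂ)).charpoly.roots).map (fun z : ℂ => ‖z‖)).sort (· ≥ ·)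

/-- `|λ₂(A)|`, the modulus of the second largest (in modulus) eigenvalue of `A`. A matrix with fewer
than two eigenvalues gets the value `0`. -/
noncomputable def absLambdaTwo {N : ℕ} (A : Matrix (Fin N) (Fin N) ℝ) : ℝ :=
  (eigenvalueModuli A).getD 1 0

/-- The log-moment generating function `λ ↦ log E[exp(λᵀ Y)]` of a random vector `Y`, with value
`+∞` where the expectation is infinite. -/
noncomputable def logMGF {Ω : Type*} [MeasurableSpace Ω] (μ : Measure Ω) {d : ℕ}
    (Y : Ω → Vec d) (l : Vec d) : EReal :=
  ENNReal.log (∫⁻ ω, ENNReal.ofReal (Real.exp (inner ℝ l (Y ω))) ∂μ)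

/-- The conjugate (Fenchel-Legendre transform) `x ↦ sup_λ (xᵀ λ - f(λ))`. -/
noncomputable def conjugate {d : ℕ} (f : Vec d → EReal) (x : Vec d) : EReal :=
  ⨆ l : Vec d, ((inner ℝ x l : ℝ) : EReal) - f l

/-- A rate function: a lower semicontinuous function with values in `[0, +∞]`. -/
def IsRateFunction {d : ℕ} (I : Vec d → EReal) : Prop :=
  LowerSemicontinuous I ∧ ∀ x, 0 ≤ I x

/-- The sequence `X_1, X_2, …` satisfies the large deviations principle (with speed `t`) with rate
function `I`. Here `log 0 = -∞`, and the infimum over the empty set is `+∞`. -/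
def SatisfiesLDP {Ω : Type*} [MeasurableSpace Ω] (μ : Measure Ω) {d : ℕ}
    (X : ℕ → Ω → Vec d) (I : Vec d → EReal) : Prop :=
  IsRateFunction I ∧
  ∀ D : Set (Vec d), MeasurableSet D →
    - (⨅ x ∈ interior D, I x)
        ≤ liminf (fun t : ℕ => (((1 : ℝ) / (t : ℝ) : ℝ) : EReal) *
            ENNReal.log (μ {ω | X t ω ∈ D})) atTop ∧
    limsup (fun t : ℕ => (((1 : ℝ) / (t : ℝ) : ℝ) : EReal) *
            ENNReal.log (μ {ω | X t ω ∈ D})) atTop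
        ≤ - (⨅ x ∈ closure D, I x)

/-!
Unrolling the recursion, `t • X_{i,t} = ∑_{s < t} ∑_j (A^(t-s))_{ij} • Z_{j,s+1}`
(`nodeState_const_eq`). By independence the scaled log-moment generating function of `X_{i,t}` is
therefore the Cesàro mean over `k = 1, …, t` of `∑_j Λ_j((A^k)_{ij} λ)`. The hypothesis on the second
eigenvalue forces `A^k → 1 aᵀ` (`tendsto_pow_of_absLambdaTwo_lt_one`): replacing `A` by `A - 1 aᵀ`
turns one eigenvalue `1` into `0` and leaves the others, so the spectral radius becomes less than `1`.
As the `Λ_j` are continuous, the scaled log-moment generating functions converge to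
`∑_j Λ_j(a_j λ)` (`hasScaledCGFLimit_nodeState`).

What remains is the Gärtner-Ellis theorem for a limit `L` that is finite, continuous and
differentiable along lines (`HasScaledCGFLimit.satisfiesLDP`).

* Upper bound: if `M < L*` on a closed set, finitely many half-spaces `{x | M + L l ≤ ⟪l, x⟫}` cover
  it (`exists_finset_cover`), and each of them has probability about `exp (-t M)` at most by
  Chernoff's inequality.
* Lower bound: if `y` is the gradient of `L` at `l`, then under the exponential tilt by `l` the
  states concentrate at `y`, which gives the bound at `y` (`eventually_le_measure_ball`). A general
  point `x` with `L* x < ∞` need not be a gradient. The maximizer `l` of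
  `⟪x, l⟫ - L l - (δ/2) ‖l‖²`, however, has gradient `y = x - δ l`, and `y` is close to `x` while
  `⟪l, y⟫ - L l ≤ L* x` (`exists_gradient_near`). This avoids any convex analysis of the relative
  interior of the domain of `L*`.

The concentration estimate without tilt (`l = 0`) is summable in `t`, and Borel-Cantelli yields the
almost sure convergence (`HasScaledCGFLimit.ae_tendsto`).
-/

/-! ### Powers of a stochastic matrix with a simple dominant eigenvalue -/

open Polynomial in
/-- Deflation: subtracting `1 aᵀ` from a matrix with unit row sums replaces one eigenvalue `1`, counted
with algebraic multiplicity, by `0`. -/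
lemma X_mul_charpoly_eq_of_mulVec_one {R : Type*} [CommRing R] [IsDomain R] {n : ℕ}
    (A : Matrix (Fin n) (Fin n) R) (hA : A.mulVec 1 = 1) (a : Fin n → R) (ha1 : ∑ j, a j = 1) :
    X * A.charpoly = (X - 1) * (A - Matrix.vecMulVec 1 a).charpoly := by
  have hn : n ≠ 0 := by
    rintro rfl
    simp at ha1
  set u : Fin n → R[X] := fun j => C (a j) with hu
  have hchar : ∀ M : Matrix (Fin n) (Fin n) R,
      M.charmatrix = Matrix.scalar (Fin n) (X : R[X]) - M.map C := fun _ => rfl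
  have hsum : (∑ j, u j : R[X]) = 1 := by rw [← map_sum, ha1, map_one]
  have hAP : A.map C * Matrix.vecMulVec 1 u = Matrix.vecMulVec 1 u := by
    rw [Matrix.mul_vecMulVec]
    congr 1
    ext1 i
    have h := congrArg C (congrFun hA i)
    simpa [Matrix.mulVec, dotProduct] using h
  -- `(X - A) ((X - 1) + 1 aᵀ) = (X - 1) (X - A + 1 aᵀ)`, because `A 1 = 1`.
  have hmul : A.charmatrix * (Matrix.scalar (Fin n) (X - 1 : R[X]) - -Matrix.vecMulVec 1 u)
      = (X - 1 : R[X]) • (A - Matrix.vecMulVec 1 a).charmatrix := by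
    have hB : (A - Matrix.vecMulVec 1 a).map C = A.map C - Matrix.vecMulVec 1 u := by
      ext1 i j
      simp [hu]
    have hscalar : ∀ p : R[X], Matrix.scalar (Fin n) p = p • 1 := fun p => by
      rw [Matrix.smul_one_eq_diagonal]; rfl
    rw [hchar, hchar, hB, hscalar, hscalar, sub_neg_eq_add, mul_add, mul_smul_comm, mul_one,
      sub_mul, hAP, smul_mul_assoc, one_mul, sub_sub_eq_add_sub, add_comm, smul_sub, smul_sub,
      smul_add, sub_smul X 1 (Matrix.vecMulVec 1 u), one_smul]
    abel
  -- The determinant of `(X - 1) + 1 aᵀ` is the value at `X - 1` of a rank one characteristic polynomial.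
  have hdet := congrArg Matrix.det hmul
  rw [Matrix.det_mul, Matrix.det_smul, ← Matrix.eval_charpoly, ← Matrix.neg_vecMulVec,
    Matrix.charpoly_vecMulVec, Fintype.card_fin] at hdet
  have hdot : (-1 : Fin n → R[X]) ⬝ᵥ u = -1 := by
    simp [dotProduct, Finset.sum_neg_distrib, hsum]
  rw [hdot] at hdet
  obtain ⟨m, rfl⟩ := Nat.exists_eq_succ_of_ne_zero hn
  simp only [Nat.succ_eq_add_one, Nat.add_sub_cancel, eval_sub, eval_pow, eval_X,
    neg_smul, one_smul, eval_neg] at hdet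
  have hne : ((X : R[X]) - 1) ^ m ≠ 0 := pow_ne_zero _ (by simpa using X_sub_C_ne_zero (1 : R))
  apply mul_left_cancel₀ hne
  rw [Matrix.charpoly, Matrix.charpoly]
  linear_combination hdet

/-- If `|λ₂(A)| < 1` and `1` is an eigenvalue of `A`, then every other eigenvalue, in the count with
algebraic multiplicity, lies in the open unit disc. -/
lemma norm_lt_one_of_charpoly_roots_eq_cons {N : ℕ} (A : Matrix (Fin N) (Fin N) ℝ)
    (hlam : absLambdaTwo A < 1)
    (R : Multiset ℂ) (hR : (A.map (algebraMap ℝ ℂ)).charpoly.roots = 1 ::ₘ R) (z : ℂ)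
    (hz : z ∈ R) : ‖z‖ < 1 := by
  by_contra! hz1
  obtain ⟨R', rfl⟩ := Multiset.exists_cons_of_mem hz
  set l := eigenvalueModuli A with hl
  have hperm : (l : Multiset ℝ) = 1 ::ₘ ‖z‖ ::ₘ R'.map (fun z : ℂ => ‖z‖) := by
    rw [hl, eigenvalueModuli, Multiset.sort_eq, hR]
    simp
  have hsort : l.Pairwise (· ≥ ·) := Multiset.pairwise_sort _ _
  have hlen : 2 ≤ (l.filter (fun r => 1 ≤ r)).length := by
    have h := congrArg (fun m => Multiset.card (m.filter (fun r : ℝ => 1 ≤ r))) hperm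
    simp only [Multiset.filter_coe, Multiset.coe_card] at h
    rw [h, Multiset.filter_cons_of_pos _ le_rfl, Multiset.filter_cons_of_pos _ hz1]
    simp
  -- The list has two entries `≥ 1`, but it is decreasing and its second entry is `< 1`.
  have hl1 : l.getD 1 0 < 1 := hlam
  match l, hsort, hlen, hl1 with
  | [], _, h, _ => simp at h
  | [x], _, h, _ =>
    have := h.trans (List.length_filter_le _ _)
    simp at this
  | x :: y :: l', hs, h, h1 =>
    have hy : y < 1 := by simpa using h1
    have hnil : (y :: l').filter (fun r => 1 ≤ r) = [] := by
      rw [List.filter_eq_nil_iff]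
      intro r hr
      have hry : r ≤ y := by
        rcases List.mem_cons.1 hr with rfl | hr
        · exact le_rfl
        · exact (List.pairwise_cons.1 (List.pairwise_cons.1 hs).2).1 r hr
      simpa using hry.trans_lt hy
    rw [List.filter_cons, hnil] at h
    split_ifs at h <;> simp at h

open scoped Matrix.Norms.Operator in
/-- By Gelfand's formula, the powers of a matrix with all eigenvalues in the open unit disc tend to `0`. -/
lemma Matrix.tendsto_pow_zero_of_charpoly_roots_norm_lt_one {N : ℕ} (B : Matrix (Fin N) (Fin N) ℂ)
    (hB : ∀ z, B.charpoly.IsRoot z → ‖z‖ < 1) : Tendsto (fun k => B ^ k) atTop (𝓝 0) := by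
  rcases isEmpty_or_nonempty (Fin N) with h | h
  · exact tendsto_const_nhds.congr fun _ => Subsingleton.elim _ _
  have hr : spectralRadius ℂ B < 1 := by
    apply spectrum.spectralRadius_lt_of_forall_lt B (r := 1)
    intro z hz
    exact hB z (Matrix.mem_spectrum_iff_isRoot_charpoly.1 hz)
  obtain ⟨r, hr1, hr2⟩ := exists_between hr
  have hev := (spectrum.pow_nnnorm_pow_one_div_tendsto_nhds_spectralRadius B).eventually_lt_const hr1
  suffices h0 : Tendsto (fun k => ‖B ^ k‖ₑ) atTop (𝓝 0) from
    tendsto_zero_iff_enorm_tendsto_zero.2 h0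
  refine tendsto_of_tendsto_of_tendsto_of_le_of_le' tendsto_const_nhds
    (ENNReal.tendsto_pow_atTop_nhds_zero_of_lt_one hr2) (Eventually.of_forall fun _ => zero_le) ?_
  filter_upwards [hev, eventually_gt_atTop 0] with k hk hk0
  have hk' : (0 : ℝ) < k := by exact_mod_cast hk0
  have := ENNReal.rpow_le_rpow hk.le hk'.le
  rwa [← ENNReal.rpow_mul, one_div, inv_mul_cancel₀ hk'.ne', ENNReal.rpow_one,
    ENNReal.rpow_natCast] at this

/-- The powers of `A` tend to the rank one matrix `1 aᵀ`, entry by entry. -/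
theorem tendsto_pow_of_absLambdaTwo_lt_one {N : ℕ} (A : Matrix (Fin N) (Fin N) ℝ)
    (hA : A.mulVec 1 = 1) (hlam : absLambdaTwo A < 1)
    (a : Fin N → ℝ) (ha : Matrix.vecMul a A = a) (ha1 : ∑ j, a j = 1) (i j : Fin N) :
    Tendsto (fun k => (A ^ k) i j) atTop (𝓝 (a j)) := by
  set P : Matrix (Fin N) (Fin N) ℝ := Matrix.vecMulVec 1 a with hP
  have hAP : A * P = P := by rw [hP, Matrix.mul_vecMulVec, hA]
  have hPA : P * A = P := by rw [hP, Matrix.vecMulVec_mul, ha]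
  have hPP : P * P = P := by
    rw [hP, Matrix.vecMulVec_mul, Matrix.vecMul_vecMulVec]
    simp [dotProduct, ha1]
  -- The identity fails for `k = 0`, hence the shift by one.
  have hpow : ∀ k, (A - P) ^ (k + 1) = A ^ (k + 1) - P := by
    intro k
    induction k with
    | zero => simp
    | succ k ih =>
      have hAkP : ∀ m, A ^ m * P = P := by
        intro m
        induction m with
        | zero => simp
        | succ m ihm => rw [pow_succ, mul_assoc, hAP, ihm]
      rw [pow_succ, ih, sub_mul, mul_sub, mul_sub, hPA, hPP, hAkP, ← pow_succ]
      abel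
  have hroot : ∀ z, ((A - P).map (algebraMap ℝ ℂ)).charpoly.IsRoot z → ‖z‖ < 1 := by
    intro z hz
    set Ac := A.map (algebraMap ℝ ℂ) with hAc
    set ac : Fin N → ℂ := fun j => (a j : ℂ)
    have hAc1 : Ac.mulVec 1 = 1 := by
      ext i
      have := congrArg (fun r : ℝ => (r : ℂ)) (congrFun hA i)
      simpa [Matrix.mulVec, dotProduct, hAc] using this
    have hBc : (A - P).map (algebraMap ℝ ℂ) = Ac - Matrix.vecMulVec 1 ac := by
      ext i j
      simp [hAc, hP, ac]
    rw [hBc] at hz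
    have hac1 : ∑ j, ac j = 1 := by simp only [ac]; exact_mod_cast ha1
    have key := X_mul_charpoly_eq_of_mulVec_one Ac hAc1 ac hac1
    have hA0 : Ac.charpoly ≠ 0 := (Matrix.charpoly_monic _).ne_zero
    have hB0 : (Ac - Matrix.vecMulVec 1 ac).charpoly ≠ 0 := (Matrix.charpoly_monic _).ne_zero
    have hX1 : (Polynomial.X - 1 : Polynomial ℂ) ≠ 0 := by
      simpa using Polynomial.X_sub_C_ne_zero (1 : ℂ)
    have hroots := congrArg Polynomial.roots key
    rw [Polynomial.roots_mul (mul_ne_zero Polynomial.X_ne_zero hA0),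
      Polynomial.roots_mul (mul_ne_zero hX1 hB0), Polynomial.roots_X,
      ← Polynomial.C_1, Polynomial.roots_X_sub_C] at hroots
    have h1 : (1 : ℂ) ∈ Ac.charpoly.roots := by
      have : (1 : ℂ) ∈ ({0} + Ac.charpoly.roots : Multiset ℂ) := by rw [hroots]; simp
      simpa using this
    obtain ⟨R, hR⟩ := Multiset.exists_cons_of_mem h1
    have hBR : (Ac - Matrix.vecMulVec 1 ac).charpoly.roots = 0 ::ₘ R := by
      rw [hR] at hroots
      rw [Multiset.singleton_add, Multiset.singleton_add, Multiset.cons_swap] at hroots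
      exact ((Multiset.cons_inj_right _).1 hroots).symm
    have hzm : z ∈ (0 ::ₘ R : Multiset ℂ) := by
      rw [← hBR]; exact (Polynomial.mem_roots hB0).2 hz
    rcases Multiset.mem_cons.1 hzm with rfl | hzR
    · simp
    · exact norm_lt_one_of_charpoly_roots_eq_cons A hlam R hR z hzR
  have hlim := Matrix.tendsto_pow_zero_of_charpoly_roots_norm_lt_one _ hroot
  have hij : Tendsto (fun k => (((A - P).map (algebraMap ℝ ℂ)) ^ k) i j) atTop (𝓝 0) :=
    ((continuous_apply_apply i j).tendsto _).comp hlim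
  have hre : Tendsto (fun k => ((A - P) ^ k) i j) atTop (𝓝 0) := by
    have := (Complex.continuous_re.tendsto _).comp hij
    refine this.congr fun k => ?_
    have : ((A - P).map (algebraMap ℝ ℂ)) ^ k = ((A - P) ^ k).map (algebraMap ℝ ℂ) :=
      (map_pow (algebraMap ℝ ℂ).mapMatrix (A - P) k).symm
    simp only [Function.comp_apply, this]
    simp
  rw [← tendsto_add_atTop_iff_nat 1] at hre ⊢
  have := hre.add_const (a j)
  rw [zero_add] at this
  refine this.congr fun k => ?_
  rw [hpow]
  simp [hP]

/-! ### Exponential rates and the directions of the coordinate axes -/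

lemma mul_log_le_iff {t : ℕ} (ht : 0 < t) (m : ENNReal) (c : ℝ) :
    (((1 : ℝ) / (t : ℝ) : ℝ) : EReal) * ENNReal.log m ≤ c ↔
      m ≤ ENNReal.ofReal (Real.exp (t * c)) := by
  have ht' : (0 : ℝ) < t := by exact_mod_cast ht
  rw [← ENNReal.log_le_log_iff, ENNReal.log_ofReal_of_pos (Real.exp_pos _), Real.log_exp]
  induction h : ENNReal.log m using EReal.rec with
  | bot =>
    rw [EReal.coe_mul_bot_of_pos (one_div_pos.2 ht')]
    exact iff_of_true bot_le bot_le
  | top =>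
    rw [EReal.coe_mul_top_of_pos (one_div_pos.2 ht')]
    simp only [top_le_iff, EReal.coe_ne_top]
  | coe x =>
    rw [← EReal.coe_mul, EReal.coe_le_coe_iff, EReal.coe_le_coe_iff, one_div_mul_eq_div,
      div_le_iff₀' ht']

lemma le_mul_log_iff {t : ℕ} (ht : 0 < t) (m : ENNReal) (c : ℝ) :
    (c : EReal) ≤ (((1 : ℝ) / (t : ℝ) : ℝ) : EReal) * ENNReal.log m ↔
      ENNReal.ofReal (Real.exp (t * c)) ≤ m := by
  have ht' : (0 : ℝ) < t := by exact_mod_cast ht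
  rw [← ENNReal.log_le_log_iff, ENNReal.log_ofReal_of_pos (Real.exp_pos _), Real.log_exp]
  induction h : ENNReal.log m using EReal.rec with
  | bot =>
    rw [EReal.coe_mul_bot_of_pos (one_div_pos.2 ht')]
    simp only [le_bot_iff, EReal.coe_ne_bot]
  | top =>
    rw [EReal.coe_mul_top_of_pos (one_div_pos.2 ht')]
    exact iff_of_true le_top le_top
  | coe x =>
    rw [← EReal.coe_mul, EReal.coe_le_coe_iff, EReal.coe_le_coe_iff, one_div_mul_eq_div,
      le_div_iff₀' ht']

/-- A constant factor does not change an exponential rate. -/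
lemma eventually_const_mul_exp_le (K : ℝ) {b c : ℝ} (h : b < c) :
    ∀ᶠ t : ℕ in atTop, K * Real.exp (t * b) ≤ Real.exp (t * c) := by
  have h1 : Tendsto (fun t : ℕ => Real.exp (t * (c - b))) atTop atTop :=
    Real.tendsto_exp_atTop.comp (tendsto_natCast_atTop_atTop.atTop_mul_const (sub_pos.2 h))
  filter_upwards [h1.eventually_ge_atTop K] with t ht
  calc K * Real.exp (t * b) ≤ Real.exp (t * (c - b)) * Real.exp (t * b) := by gcongr
    _ = Real.exp (t * c) := by rw [← Real.exp_add]; ring_nf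

/-- The unit vectors `± e_k` of `ℝ^d`. -/
noncomputable def signedBasis (d : ℕ) : Finset (Vec d) := by
  classical exact Finset.univ.image fun p : Fin d × Bool =>
    bif p.2 then EuclideanSpace.single p.1 (1 : ℝ) else -EuclideanSpace.single p.1 (1 : ℝ)

/-- A vector of norm at least `ε` lies in one of finitely many half-spaces away from the origin. -/
lemma exists_le_inner_of_le_norm {d : ℕ} {ε : ℝ} (hε : 0 < ε) (z : Vec d) (hz : ε ≤ ‖z‖) :
    ∃ v ∈ signedBasis d, ε / (d + 1) ≤ inner ℝ v z := by
  by_contra! hcon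
  have hk : ∀ k, |z k| ≤ ε / (d + 1) := by
    intro k
    rw [abs_le']
    constructor
    · have := hcon (EuclideanSpace.single k 1) (Finset.mem_image.2 ⟨(k, true), by simp⟩)
      simpa [EuclideanSpace.inner_single_left] using this.le
    · have := hcon (-EuclideanSpace.single k 1) (Finset.mem_image.2 ⟨(k, false), by simp⟩)
      simpa [EuclideanSpace.inner_single_left] using this.le
  have hsum : ‖z‖ ≤ ∑ k, |z k| := by
    have : z = ∑ k, EuclideanSpace.single k (z k) := by
      ext j
      simp [Finset.sum_apply, Pi.single_apply]
    calc ‖z‖ = ‖∑ k, EuclideanSpace.single k (z k)‖ := by rw [← this]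
      _ ≤ ∑ k, ‖EuclideanSpace.single k (z k)‖ := norm_sum_le _ _
      _ = ∑ k, |z k| := by simp
  have : ‖z‖ ≤ d * (ε / (d + 1)) := hsum.trans ((Finset.sum_le_sum fun k _ => hk k).trans (by simp))
  have h2 : d * (ε / (d + 1)) < ε := by
    rw [mul_div_assoc', div_lt_iff₀ (by positivity)]
    nlinarith
  linarith

/-! ### Concentration and lower bounds from the scaled log-moment generating functions -/

/-- The random vectors `X_t` have finite exponential moments, and their scaled log-moment generating
functions `l ↦ (1/t) log E[exp(t ⟪l, X_t⟫)]` converge pointwise to the real-valued function `L`. -/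
structure HasScaledCGFLimit {Ω : Type*} [MeasurableSpace Ω] (μ : Measure Ω) {d : ℕ}
    (X : ℕ → Ω → Vec d) (L : Vec d → ℝ) : Prop where
  measurable : ∀ t, Measurable (X t)
  integrable : ∀ t l, Integrable (fun ω => Real.exp (t * inner ℝ l (X t ω))) μ
  tendsto : ∀ l, Tendsto (fun t : ℕ => 1 / (t : ℝ) *
    Real.log (∫ ω, Real.exp (t * inner ℝ l (X t ω)) ∂μ)) atTop (𝓝 (L l))

namespace HasScaledCGFLimit

variable {Ω : Type*} [MeasurableSpace Ω] {μ : Measure Ω} {d : ℕ}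
    {X : ℕ → Ω → Vec d} {L : Vec d → ℝ}

/-- Chernoff's inequality for a half-space under the (unnormalized) exponential tilt by `l`. -/
lemma setIntegral_halfspace_le (h : HasScaledCGFLimit μ X L) (t : ℕ) (l w : Vec d) (r : ℝ) :
    ∫ ω in {ω | r ≤ inner ℝ w (X t ω)}, Real.exp (t * inner ℝ l (X t ω)) ∂μ
      ≤ Real.exp (-(t * r)) * ∫ ω, Real.exp (t * inner ℝ (l + w) (X t ω)) ∂μ := by
  have hm : MeasurableSet {ω | r ≤ inner ℝ w (X t ω)} :=
    measurableSet_le measurable_const (measurable_const.inner (h.measurable t))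
  rw [← integral_const_mul]
  calc ∫ ω in {ω | r ≤ inner ℝ w (X t ω)}, Real.exp (t * inner ℝ l (X t ω)) ∂μ
      ≤ ∫ ω in {ω | r ≤ inner ℝ w (X t ω)},
          Real.exp (-(t * r)) * Real.exp (t * inner ℝ (l + w) (X t ω)) ∂μ := by
        apply setIntegral_mono_on (h.integrable t l).integrableOn
          ((h.integrable t _).const_mul _).integrableOn hm
        intro ω hω
        rw [← Real.exp_add, inner_add_left]
        gcongr
        have : (t : ℝ) * r ≤ t * inner ℝ w (X t ω) := by
          gcongr
          exact hω
        linarith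
    _ ≤ ∫ ω, Real.exp (-(t * r)) * Real.exp (t * inner ℝ (l + w) (X t ω)) ∂μ :=
        setIntegral_le_integral ((h.integrable t _).const_mul _)
          (Eventually.of_forall fun ω => by positivity)

variable [IsProbabilityMeasure μ]

lemma integral_pos (h : HasScaledCGFLimit μ X L) (t : ℕ) (l : Vec d) :
    0 < ∫ ω, Real.exp (t * inner ℝ l (X t ω)) ∂μ :=
  integral_exp_pos (h.integrable t l)

lemma eventually_integral_le (h : HasScaledCGFLimit μ X L) (l : Vec d) {c : ℝ} (hc : L l < c) :
    ∀ᶠ t : ℕ in atTop, ∫ ω, Real.exp (t * inner ℝ l (X t ω)) ∂μ ≤ Real.exp (t * c) := by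
  filter_upwards [(h.tendsto l).eventually_lt_const hc, eventually_gt_atTop 0] with t ht ht0
  have ht' : (0 : ℝ) < t := by exact_mod_cast ht0
  rw [one_div_mul_eq_div, div_lt_iff₀' ht'] at ht
  exact ((Real.log_lt_iff_lt_exp (h.integral_pos t l)).1 ht).le

lemma eventually_le_integral (h : HasScaledCGFLimit μ X L) (l : Vec d) {c : ℝ} (hc : c < L l) :
    ∀ᶠ t : ℕ in atTop, Real.exp (t * c) ≤ ∫ ω, Real.exp (t * inner ℝ l (X t ω)) ∂μ := by
  filter_upwards [(h.tendsto l).eventually_const_lt hc, eventually_gt_atTop 0] with t ht ht0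
  have ht' : (0 : ℝ) < t := by exact_mod_cast ht0
  rw [one_div_mul_eq_div, lt_div_iff₀' ht'] at ht
  exact ((Real.lt_log_iff_exp_lt (h.integral_pos t l)).1 ht).le

lemma apply_zero (h : HasScaledCGFLimit μ X L) : L 0 = 0 :=
  tendsto_nhds_unique (h.tendsto 0) (by simp)

/-- If `⟪v, y⟫` is the derivative of `L` at `l` in direction `v`, then under the tilt by `l`, whose total
mass is about `exp (t L(l))`, the half-space beyond `y` in direction `v` has exponentially small relative
mass. -/
lemma eventually_setIntegral_halfspace_le (h : HasScaledCGFLimit μ X L) {l y v : Vec d}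
    (hderiv : HasDerivAt (fun s : ℝ => L (l + s • v)) (inner ℝ v y) 0) {ε : ℝ} (hε : 0 < ε) :
    ∃ c > 0, ∀ᶠ t : ℕ in atTop,
      ∫ ω in {ω | ε ≤ inner ℝ v (X t ω - y)}, Real.exp (t * inner ℝ l (X t ω)) ∂μ
        ≤ Real.exp (t * (L l - c)) := by
  -- Chernoff with the additional tilt `s • v`; for small `s` the gain `s ε` beats the second order term.
  obtain ⟨s, hs0, hs⟩ : ∃ s > 0, L (l + s • v) < L l + s * (inner ℝ v y + ε) := by
    have h1 := (hderiv.tendsto_slope_zero_right).eventually_lt_const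
      (lt_add_of_pos_right (inner ℝ v y) hε)
    obtain ⟨s, hs, hs0⟩ := (h1.and self_mem_nhdsWithin).exists
    refine ⟨s, hs0, ?_⟩
    simp only [zero_add, zero_smul, add_zero, smul_eq_mul] at hs
    rw [inv_mul_lt_iff₀ hs0] at hs
    linarith
  refine ⟨(L l + s * (inner ℝ v y + ε) - L (l + s • v)) / 2, by linarith, ?_⟩
  filter_upwards [h.eventually_integral_le (l + s • v) (c := L (l + s • v) +
    (L l + s * (inner ℝ v y + ε) - L (l + s • v)) / 2) (by linarith)] with t ht
  have hset : {ω | ε ≤ inner ℝ v (X t ω - y)}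
      = {ω | s * (inner ℝ v y + ε) ≤ inner ℝ (s • v) (X t ω)} := by
    ext ω
    simp only [Set.mem_ofPred_eq, inner_smul_left, inner_sub_right, RCLike.conj_to_real]
    rw [mul_le_mul_iff_right₀ hs0, le_sub_iff_add_le']
  rw [hset]
  refine (h.setIntegral_halfspace_le t l (s • v) _).trans ?_
  refine (mul_le_mul_of_nonneg_left ht (Real.exp_pos _).le).trans_eq ?_
  rw [← Real.exp_add]
  congr 1
  ring

/-- Under the tilt by `l`, the vectors `X_t` concentrate exponentially fast at the gradient `y` of `L` at
`l`. -/
lemma eventually_setIntegral_norm_le (h : HasScaledCGFLimit μ X L) {l y : Vec d}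
    (hderiv : ∀ v, HasDerivAt (fun s : ℝ => L (l + s • v)) (inner ℝ v y) 0) {ε : ℝ} (hε : 0 < ε) :
    ∃ c > 0, ∀ᶠ t : ℕ in atTop,
      ∫ ω in {ω | ε ≤ ‖X t ω - y‖}, Real.exp (t * inner ℝ l (X t ω)) ∂μ
        ≤ Real.exp (t * (L l - c)) := by
  set S : Finset (Vec d) := signedBasis d
  have hε' : 0 < ε / (d + 1) := by positivity
  choose c hc0 hc using fun v => h.eventually_setIntegral_halfspace_le (hderiv v) hε'
  obtain ⟨b, hb0, hb⟩ : ∃ b > 0, ∀ v ∈ S, b ≤ c v := by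
    have := (Filter.eventually_all_finset S).2 fun v _ =>
      (eventually_le_nhds (hc0 v)).filter_mono (nhdsWithin_le_nhds (s := Set.Ioi 0))
    obtain ⟨b, hb, hb0⟩ := (this.and self_mem_nhdsWithin).exists
    exact ⟨b, hb0, hb⟩
  refine ⟨b / 2, by positivity, ?_⟩
  filter_upwards [(Filter.eventually_all_finset S).2 fun v _ => hc v,
    eventually_const_mul_exp_le (S.card : ℝ) (show L l - b < L l - b / 2 by linarith)] with t h1 h2
  refine le_trans ?_ h2
  have hnn : ∀ s : Set Ω, 0 ≤ᵐ[μ.restrict s] fun ω => Real.exp (t * inner ℝ l (X t ω)) :=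
    fun s => Eventually.of_forall fun ω => (Real.exp_pos _).le
  have hfin : ∀ s : Set Ω, ∫⁻ ω in s, ENNReal.ofReal (Real.exp (t * inner ℝ l (X t ω))) ∂μ
      = ENNReal.ofReal (∫ ω in s, Real.exp (t * inner ℝ l (X t ω)) ∂μ) := fun s =>
    (ofReal_integral_eq_lintegral_ofReal (h.integrable t l).integrableOn (hnn s)).symm
  rw [← ENNReal.ofReal_le_ofReal_iff (by positivity), ← hfin]
  calc _ ≤ ∫⁻ ω in ⋃ v : S, {ω | ε / (d + 1) ≤ inner ℝ (v : Vec d) (X t ω - y)},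
          ENNReal.ofReal (Real.exp (t * inner ℝ l (X t ω))) ∂μ := by
        apply lintegral_mono_set
        intro ω hω
        obtain ⟨v, hv, hv'⟩ := exists_le_inner_of_le_norm hε _ hω
        exact Set.mem_iUnion.2 ⟨⟨v, hv⟩, hv'⟩
    _ ≤ ∑ v ∈ S, ∫⁻ ω in {ω | ε / (d + 1) ≤ inner ℝ v (X t ω - y)},
          ENNReal.ofReal (Real.exp (t * inner ℝ l (X t ω))) ∂μ := by
        rw [← Finset.sum_coe_sort]
        exact (lintegral_iUnion_le _ _).trans_eq (tsum_fintype _)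
    _ ≤ ∑ v ∈ S, ENNReal.ofReal (Real.exp (t * (L l - b))) := by
        gcongr with v hv
        rw [hfin]
        apply ENNReal.ofReal_le_ofReal
        refine (h1 v hv).trans ?_
        gcongr
        exact hb v hv
    _ = _ := by
        rw [Finset.sum_const, nsmul_eq_mul, ENNReal.ofReal_mul (by positivity)]
        simp

/-- The lower bound at a gradient `y` of `L`, with the rate `⟪l, y⟫ - L l`: change of measure by the tilt
at `l`. -/
lemma eventually_le_measure_ball (h : HasScaledCGFLimit μ X L) {l y : Vec d}
    (hderiv : ∀ v, HasDerivAt (fun s : ℝ => L (l + s • v)) (inner ℝ v y) 0) {ε : ℝ} (hε : 0 < ε)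
    {r : ℝ} (hr : r < L l - inner ℝ l y) :
    ∀ᶠ t : ℕ in atTop, Real.exp (t * r) ≤ μ.real {ω | X t ω ∈ Metric.ball y ε} := by
  set η : ℝ := (L l - inner ℝ l y - r) / 4 with hη
  have hη0 : 0 < η := by simp only [hη]; linarith
  obtain ⟨δ, hδ0, hδε, hδ⟩ : ∃ δ > 0, δ ≤ ε ∧ ‖l‖ * δ ≤ η := by
    refine ⟨min ε (η / (‖l‖ + 1)), lt_min hε (by positivity), min_le_left _ _, ?_⟩
    calc ‖l‖ * min ε (η / (‖l‖ + 1)) ≤ (‖l‖ + 1) * (η / (‖l‖ + 1)) := by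
          gcongr
          · linarith
          · exact min_le_right _ _
      _ = η := by field_simp
  -- On the ball of radius `δ` the density of the tilt is at most `exp (t (⟪l, y⟫ + η))`.
  obtain ⟨c, hc0, hc⟩ := h.eventually_setIntegral_norm_le hderiv hδ0
  filter_upwards [hc, h.eventually_le_integral l (show L l - min c η / 2 < L l by
      have := lt_min hc0 hη0; linarith),
    eventually_const_mul_exp_le 2 (show L l - c < L l - min c η / 2 by
      have := min_le_left c η; linarith),
    eventually_const_mul_exp_le 2 (show r < L l - min c η / 2 - inner ℝ l y - η by
      have := min_le_right c η; linarith)] with t h1 h2 h3 h4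
  have hm : MeasurableSet {ω | δ ≤ ‖X t ω - y‖} :=
    measurableSet_le measurable_const ((h.measurable t).sub_const y).norm
  have hsplit := integral_add_compl hm (h.integrable t l)
  have hcompl : ∫ ω in {ω | δ ≤ ‖X t ω - y‖}ᶜ, Real.exp (t * inner ℝ l (X t ω)) ∂μ
      ≤ Real.exp (t * (inner ℝ l y + η)) * μ.real {ω | X t ω ∈ Metric.ball y ε} := by
    calc ∫ ω in {ω | δ ≤ ‖X t ω - y‖}ᶜ, Real.exp (t * inner ℝ l (X t ω)) ∂μ
        ≤ ∫ ω in {ω | δ ≤ ‖X t ω - y‖}ᶜ, Real.exp (t * (inner ℝ l y + η)) ∂μ := by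
          apply setIntegral_mono_on (h.integrable t l).integrableOn
            (integrable_const _).integrableOn hm.compl
          intro ω hω
          have hω' : ‖X t ω - y‖ < δ := by simpa using hω
          have h5 : inner ℝ l (X t ω) = inner ℝ l y + inner ℝ l (X t ω - y) := by
            rw [inner_sub_right]; ring
          have h6 : inner ℝ l (X t ω - y) ≤ ‖l‖ * δ :=
            (real_inner_le_norm _ _).trans (by gcongr)
          rw [h5]
          gcongr
          linarith
      _ = Real.exp (t * (inner ℝ l y + η)) * μ.real {ω | δ ≤ ‖X t ω - y‖}ᶜ := by
          rw [setIntegral_const, smul_eq_mul, mul_comm]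
      _ ≤ _ := by
          gcongr
          · exact measure_ne_top _ _
          · intro ω hω
            have hω' : ‖X t ω - y‖ < δ := by simpa using hω
            exact mem_ball_iff_norm.2 (hω'.trans_le hδε)
  have h7 : Real.exp (t * (L l - min c η / 2)) / 2
      ≤ Real.exp (t * (inner ℝ l y + η)) * μ.real {ω | X t ω ∈ Metric.ball y ε} := by
    linarith
  have h8 : Real.exp (t * (L l - min c η / 2 - inner ℝ l y - η))
      * Real.exp (t * (inner ℝ l y + η)) = Real.exp (t * (L l - min c η / 2)) := by
    rw [← Real.exp_add]; ring_nf
  have h9 := Real.exp_pos (t * (inner ℝ l y + η))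
  rw [← h8] at h7
  have h10 : Real.exp (t * (L l - min c η / 2 - inner ℝ l y - η)) / 2
      ≤ μ.real {ω | X t ω ∈ Metric.ball y ε} := by
    rw [mul_div_right_comm, mul_comm (Real.exp (t * (inner ℝ l y + η)))] at h7
    exact le_of_mul_le_mul_right h7 h9
  linarith

/-- The strong law of large numbers, with limit the gradient of `L` at the origin. -/
lemma ae_tendsto (h : HasScaledCGFLimit μ X L) {y : Vec d}
    (hderiv : ∀ v, HasDerivAt (fun s : ℝ => L (s • v)) (inner ℝ v y) 0) :
    ∀ᵐ ω ∂μ, Tendsto (fun t => X t ω) atTop (𝓝 y) := by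
  have key : ∀ n : ℕ, ∀ᵐ ω ∂μ, ∀ᶠ t in atTop, ‖X t ω - y‖ < 1 / ((n : ℝ) + 1) := by
    intro n
    have hn : 0 < 1 / ((n : ℝ) + 1) := by positivity
    obtain ⟨c, hc0, hc⟩ := h.eventually_setIntegral_norm_le (l := 0) (y := y)
      (by simpa using hderiv) hn
    obtain ⟨T, hT⟩ := eventually_atTop.1 hc
    have hle : ∀ t, μ {ω | 1 / ((n : ℝ) + 1) ≤ ‖X (t + T) ω - y‖}
        ≤ ENNReal.ofReal (Real.exp (-c) ^ (t + T)) := by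
      intro t
      have := hT (t + T) (by omega)
      simp only [inner_zero_left, mul_zero, Real.exp_zero, h.apply_zero] at this
      rw [setIntegral_const, smul_eq_mul, mul_one] at this
      rw [← ofReal_measureReal]
      apply ENNReal.ofReal_le_ofReal
      refine this.trans_eq ?_
      rw [← Real.exp_nat_mul]
      ring_nf
    have hsum : Summable fun t : ℕ => Real.exp (-c) ^ (t + T) :=
      (summable_nat_add_iff T).2 (summable_geometric_of_lt_one (Real.exp_pos _).le
        (Real.exp_lt_one_iff.2 (by linarith)))
    have hfin : ∑' t, μ {ω | 1 / ((n : ℝ) + 1) ≤ ‖X (t + T) ω - y‖} ≠ ⊤ := by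
      refine ne_top_of_le_ne_top ?_ (ENNReal.tsum_le_tsum hle)
      exact hsum.tsum_ofReal_ne_top
    filter_upwards [ae_eventually_notMem hfin] with ω hω
    rw [← map_add_atTop_eq_nat T, eventually_map]
    exact hω.mono fun t ht => not_le.1 ht
  rw [← ae_all_iff] at key
  filter_upwards [key] with ω hω
  rw [Metric.tendsto_nhds]
  intro ε hε
  obtain ⟨n, hn⟩ := exists_nat_one_div_lt hε
  filter_upwards [hω n] with t ht
  rw [dist_eq_norm]
  exact ht.trans hn

end HasScaledCGFLimit

/-! ### The conjugate function -/

section Conjugate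

variable {d : ℕ} {L : Vec d → ℝ}

lemma conjugate_coe_eq (L : Vec d → ℝ) (x : Vec d) :
    conjugate (fun l => (L l : EReal)) x = ⨆ l, ((inner ℝ x l - L l : ℝ) : EReal) := by
  simp only [conjugate, EReal.coe_sub]

lemma isRateFunction_conjugate (h0 : L 0 = 0) :
    IsRateFunction (conjugate fun l => (L l : EReal)) := by
  refine ⟨?_, fun x => ?_⟩
  · simp only [funext (conjugate_coe_eq L)]
    apply lowerSemicontinuous_iSup
    intro l
    exact (continuous_coe_real_ereal.comp (by fun_prop)).lowerSemicontinuous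
  · rw [conjugate_coe_eq]
    exact le_iSup_of_le 0 (by simp [h0])

/-- Every point `x` at which the conjugate of `L` is at most `r` is approximated by gradients `y` of `L` at
which it is at most `r` too, in the form `⟪l, y⟫ - L l ≤ r`. The point `l` maximizes the conjugate's
objective at `x` with a quadratic penalty, which makes the maximum attained. -/
lemma exists_gradient_near (hL : Continuous L) (h0 : L 0 = 0)
    (hdiff : ∀ l v, DifferentiableAt ℝ (fun s : ℝ => L (l + s • v)) 0) {x : Vec d} {r : ℝ}
    (hx : ∀ l, inner ℝ x l - L l ≤ r) {ε : ℝ} (hε : 0 < ε) :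
    ∃ l y, dist y x < ε ∧ (∀ v, HasDerivAt (fun s : ℝ => L (l + s • v)) (inner ℝ v y) 0) ∧
      inner ℝ l y - L l ≤ r := by
  have hr : 0 ≤ r := by simpa [h0] using hx 0
  set δ : ℝ := ε ^ 2 / (2 * (r + 1)) with hδ
  have hδ0 : 0 < δ := by positivity
  set g : Vec d → ℝ := fun l => inner ℝ x l - L l - δ / 2 * ‖l‖ ^ 2 with hg
  have hgc : Continuous g := by fun_prop
  -- `⟪x, l⟫ - L l ≤ r` leaves the penalty in control at infinity.
  have hcoer : Tendsto g (cocompact _) atBot := by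
    have h1 : Tendsto (fun l : Vec d => r + -(δ / 2 * ‖l‖ ^ 2)) (cocompact _) atBot := by
      apply tendsto_atBot_add_const_left
      apply tendsto_neg_atTop_atBot.comp
      apply Tendsto.const_mul_atTop (by positivity)
      exact (tendsto_pow_atTop two_ne_zero).comp (tendsto_norm_cocompact_atTop)
    refine tendsto_atBot_mono (fun l => ?_) h1
    have := hx l
    simp only [hg]
    linarith
  obtain ⟨l, hl⟩ := hgc.exists_forall_ge hcoer
  have hgl : 0 ≤ g l := by simpa [hg, h0] using hl 0
  refine ⟨l, x - δ • l, ?_, fun v => ?_, ?_⟩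
  -- `0 = g 0 ≤ g l ≤ r - δ/2 ‖l‖²` bounds the shift `δ ‖l‖`.
  · have h1 : δ * ‖l‖ ^ 2 ≤ 2 * r := by
      have := hx l
      simp only [hg] at hgl
      linarith
    rw [dist_eq_norm, sub_sub_cancel_left, norm_neg, norm_smul, Real.norm_of_nonneg hδ0.le]
    apply lt_of_pow_lt_pow_left₀ 2 hε.le
    calc (δ * ‖l‖) ^ 2 = δ * (δ * ‖l‖ ^ 2) := by ring
      _ ≤ δ * (2 * r) := by gcongr
      _ < δ * (2 * (r + 1)) := by gcongr; linarith
      _ = ε ^ 2 := by rw [hδ]; field_simp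
  · have hD := (hdiff l v).hasDerivAt
    have hmax : IsLocalMax (fun s : ℝ => g (l + s • v)) 0 :=
      Eventually.of_forall fun s => by simpa using hl (l + s • v)
    have hline : HasDerivAt (fun s : ℝ => l + s • v) v 0 := by
      simpa using ((hasDerivAt_id (0 : ℝ)).smul_const v).const_add l
    have hinner : HasDerivAt (fun s : ℝ => inner ℝ x (l + s • v)) (inner ℝ x v) 0 := by
      simpa using (hasDerivAt_const (0 : ℝ) x).inner ℝ hline
    have hsq : HasDerivAt (fun s : ℝ => ‖l + s • v‖ ^ 2) (2 * inner ℝ l v) 0 := by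
      simpa using hline.norm_sq
    have hgd := (hinner.sub hD).sub (hsq.const_mul (δ / 2))
    have hzero := hmax.hasDerivAt_eq_zero hgd
    have : inner ℝ v (x - δ • l) = deriv (fun s : ℝ => L (l + s • v)) 0 := by
      rw [inner_sub_right, inner_smul_right, real_inner_comm x v, real_inner_comm l v]
      linarith
    rw [this]
    exact hD
  · rw [inner_sub_right, inner_smul_right, real_inner_self_eq_norm_sq, real_inner_comm]
    have := hx l
    have : 0 ≤ δ * ‖l‖ ^ 2 := by positivity
    linarith

/-- A closed set on which the conjugate of `L` exceeds `M` is covered by finitely many of the half-spaces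
`{x | M + L l ≤ ⟪l, x⟫}`: those with `l = ± e_k` cover all of it outside a ball, and compactness
provides the rest. -/
lemma exists_finset_cover (L : Vec d → ℝ) {F : Set (Vec d)} (hF : IsClosed F) {M : ℝ}
    (hM : ∀ x ∈ F, (M : EReal) < conjugate (fun l => (L l : EReal)) x) :
    ∃ S : Finset (Vec d), ∀ x ∈ F, ∃ l ∈ S, M + L l ≤ inner ℝ l x := by
  classical
  set D : Finset (Vec d) := signedBasis d
  obtain ⟨ρ, hρD, hρ0⟩ : ∃ ρ : ℝ, (∀ v ∈ D, M + L v ≤ ρ) ∧ 0 < ρ :=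
    (((Filter.eventually_all_finset D).2 fun v _ => eventually_ge_atTop (M + L v)).and
      (eventually_gt_atTop 0)).exists
  have hK : IsCompact (F ∩ Metric.closedBall 0 (ρ * (d + 1))) :=
    (isCompact_closedBall _ _).inter_left hF
  obtain ⟨T, hT⟩ := hK.elim_finite_subcover (fun l : Vec d => {x | M + L l < inner ℝ l x})
    (fun l => isOpen_lt continuous_const (by fun_prop)) (by
      intro x hx
      have := hM x hx.1
      rw [conjugate_coe_eq, lt_iSup_iff] at this
      obtain ⟨l, hl⟩ := this
      refine Set.mem_iUnion.2 ⟨l, ?_⟩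
      have hl' := EReal.coe_lt_coe_iff.1 hl
      rw [real_inner_comm] at hl'
      change M + L l < inner ℝ l x
      linarith)
  refine ⟨D ∪ T, fun x hx => ?_⟩
  by_cases hxn : ‖x‖ ≤ ρ * (d + 1)
  · obtain ⟨l, hl, hlx⟩ := Set.mem_iUnion₂.1 (hT ⟨hx, by simpa using hxn⟩)
    exact ⟨l, Finset.mem_union_right _ hl, le_of_lt hlx⟩
  · obtain ⟨v, hv, hvx⟩ := exists_le_inner_of_le_norm (by positivity) x (not_le.1 hxn).le
    refine ⟨v, Finset.mem_union_left _ hv, (hρD v hv).trans ?_⟩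
    rwa [mul_div_cancel_right₀ _ (by positivity)] at hvx

end Conjugate

/-! ### The large deviations principle -/

namespace HasScaledCGFLimit

variable {Ω : Type*} [MeasurableSpace Ω] {μ : Measure Ω} [IsProbabilityMeasure μ] {d : ℕ}
    {X : ℕ → Ω → Vec d} {L : Vec d → ℝ}

lemma eventually_measure_closed_le (h : HasScaledCGFLimit μ X L) {F : Set (Vec d)}
    (hF : IsClosed F) {M : ℝ} (hM : ∀ x ∈ F, (M : EReal) < conjugate (fun l => (L l : EReal)) x)
    {b : ℝ} (hb : -M < b) :
    ∀ᶠ t : ℕ in atTop, μ {ω | X t ω ∈ F} ≤ ENNReal.ofReal (Real.exp (t * b)) := by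
  obtain ⟨S, hS⟩ := exists_finset_cover L hF hM
  filter_upwards [(Filter.eventually_all_finset S).2 fun l _ =>
      h.eventually_integral_le l (c := L l + (M + b) / 2) (by linarith),
    eventually_const_mul_exp_le (S.card : ℝ) (show (b - M) / 2 < b by linarith)] with t h1 h2
  calc μ {ω | X t ω ∈ F} ≤ μ (⋃ l ∈ S, {ω | M + L l ≤ inner ℝ l (X t ω)}) := by
        apply measure_mono
        intro ω hω
        obtain ⟨l, hl, hlx⟩ := hS _ hω
        exact Set.mem_biUnion hl hlx
    _ ≤ ∑ l ∈ S, μ {ω | M + L l ≤ inner ℝ l (X t ω)} := measure_biUnion_finset_le _ _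
    _ ≤ ∑ l ∈ S, ENNReal.ofReal (Real.exp (t * ((b - M) / 2))) := by
        gcongr with l hl
        have h3 := h.setIntegral_halfspace_le t 0 l (M + L l)
        simp only [inner_zero_left, mul_zero, Real.exp_zero, zero_add, setIntegral_const,
          smul_eq_mul, mul_one] at h3
        rw [← ofReal_measureReal]
        apply ENNReal.ofReal_le_ofReal
        refine h3.trans ((mul_le_mul_of_nonneg_left (h1 l hl) (Real.exp_pos _).le).trans_eq ?_)
        rw [← Real.exp_add]
        congr 1
        ring
    _ = ENNReal.ofReal (S.card * Real.exp (t * ((b - M) / 2))) := by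
        rw [Finset.sum_const, nsmul_eq_mul, ENNReal.ofReal_mul (by positivity)]
        simp
    _ ≤ _ := ENNReal.ofReal_le_ofReal h2

/-- The **Gärtner-Ellis theorem** for a limit that is finite everywhere, continuous and differentiable
along lines. -/
theorem satisfiesLDP (h : HasScaledCGFLimit μ X L) (hL : Continuous L)
    (hdiff : ∀ l v, DifferentiableAt ℝ (fun s : ℝ => L (l + s • v)) 0) :
    SatisfiesLDP μ X (conjugate fun l => (L l : EReal)) := by
  refine ⟨isRateFunction_conjugate h.apply_zero, fun D _ => ⟨?_, ?_⟩⟩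
  · rw [EReal.neg_le]
    refine le_iInf₂ fun x hx => ?_
    rw [EReal.neg_le]
    apply EReal.ge_of_forall_gt_iff_ge.1
    intro z hz
    obtain ⟨ε, hε0, hε⟩ := Metric.mem_nhds_iff.1 (mem_interior_iff_mem_nhds.1 hx)
    obtain ⟨z', hz1, hz2⟩ := EReal.lt_iff_exists_real_btwn.1 hz
    have hx' : ∀ l, inner ℝ x l - L l ≤ -z' := by
      rw [EReal.lt_neg_comm, conjugate_coe_eq] at hz2
      intro l
      have := (le_iSup (fun l => ((inner ℝ x l - L l : ℝ) : EReal)) l).trans hz2.le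
      exact_mod_cast this
    obtain ⟨l, y, hy, hderiv, hly⟩ :=
      exists_gradient_near hL h.apply_zero hdiff hx' (half_pos hε0)
    have hzz : z < z' := EReal.coe_lt_coe_iff.1 hz1
    have hev := h.eventually_le_measure_ball hderiv (half_pos hε0) (r := z) (by linarith)
    refine le_liminf_of_le (by isBoundedDefault) ?_
    filter_upwards [hev, eventually_gt_atTop 0] with t ht ht0
    rw [le_mul_log_iff ht0]
    have hsub : {ω | X t ω ∈ Metric.ball y (ε / 2)} ⊆ {ω | X t ω ∈ D} := fun ω hω =>
      hε (Metric.ball_subset_ball' (by linarith) hω)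
    refine le_trans ?_ (measure_mono hsub)
    rw [← ofReal_measureReal]
    exact ENNReal.ofReal_le_ofReal ht
  · rw [EReal.le_neg]
    apply EReal.ge_of_forall_gt_iff_ge.1
    intro M hM
    rw [EReal.le_neg]
    obtain ⟨M', hM1, hM2⟩ := EReal.lt_iff_exists_real_btwn.1 hM
    have hev := h.eventually_measure_closed_le (isClosed_closure (s := D)) (M := M')
      (fun x hx => hM2.trans_le (iInf₂_le x hx)) (b := -M)
      (neg_lt_neg (EReal.coe_lt_coe_iff.1 hM1))
    refine limsup_le_of_le (by isBoundedDefault) ?_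
    filter_upwards [hev, eventually_gt_atTop 0] with t ht ht0
    rw [← EReal.coe_neg, mul_log_le_iff ht0]
    have hsub : {ω | X t ω ∈ D} ⊆ {ω | X t ω ∈ closure D} := fun ω hω => subset_closure hω
    exact (measure_mono hsub).trans ht

end HasScaledCGFLimit

/-! ### Log-moment generating functions of random vectors -/

section LogMGF

variable {Ω : Type*} [MeasurableSpace Ω] {μ : Measure Ω} {d : ℕ} {Y : Ω → Vec d}

lemma integrable_exp_inner_of_logMGF_lt_top (hY : Measurable Y) (l : Vec d)
    (h : logMGF μ Y l < ⊤) : Integrable (fun ω => Real.exp (inner ℝ l (Y ω))) μ := by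
  rw [logMGF, ENNReal.log_lt_top_iff] at h
  refine ⟨(measurable_const.inner hY).exp.aestronglyMeasurable, ?_⟩
  rwa [hasFiniteIntegral_iff_ofReal (Eventually.of_forall fun ω => (Real.exp_pos _).le)]

lemma logMGF_eq_coe [IsProbabilityMeasure μ] (l : Vec d)
    (h : Integrable (fun ω => Real.exp (inner ℝ l (Y ω))) μ) :
    logMGF μ Y l = ((Real.log (∫ ω, Real.exp (inner ℝ l (Y ω)) ∂μ) : ℝ) : EReal) := by
  rw [logMGF, ← ofReal_integral_eq_lintegral_ofReal h
    (Eventually.of_forall fun ω => (Real.exp_pos _).le),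
    ENNReal.log_ofReal_of_pos (integral_exp_pos h)]

/-- The moment generating function is finite and convex on `ℝ^d`, hence continuous. -/
lemma continuous_log_integral_exp_inner [IsProbabilityMeasure μ]
    (h : ∀ l, Integrable (fun ω => Real.exp (inner ℝ l (Y ω))) μ) :
    Continuous fun l => Real.log (∫ ω, Real.exp (inner ℝ l (Y ω)) ∂μ) := by
  have hconv : ConvexOn ℝ Set.univ fun l => ∫ ω, Real.exp (inner ℝ l (Y ω)) ∂μ := by
    refine ⟨convex_univ, fun l _ m _ p q hp hq hpq => ?_⟩
    rw [smul_eq_mul, smul_eq_mul, ← integral_const_mul, ← integral_const_mul, ← integral_add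
      ((h l).const_mul p) ((h m).const_mul q)]
    refine integral_mono (h _) (((h l).const_mul p).add ((h m).const_mul q)) fun ω => ?_
    have := convexOn_exp.2 (Set.mem_univ (inner ℝ l (Y ω))) (Set.mem_univ (inner ℝ m (Y ω)))
      hp hq hpq
    simpa [inner_add_left, inner_smul_left] using this
  have hcont : Continuous fun l => ∫ ω, Real.exp (inner ℝ l (Y ω)) ∂μ :=
    continuousOn_univ.1 (hconv.continuousOn isOpen_univ)
  exact hcont.log fun l => (integral_exp_pos (h l)).ne'

/-- Along the line through `l` in direction `v`, the moment generating function of `Y` is, up to a factor,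
that of `⟪v, Y⟫` under the tilt of `μ` by `l`. -/
lemma differentiableAt_log_integral_exp_inner [IsProbabilityMeasure μ]
    (h : ∀ l, Integrable (fun ω => Real.exp (inner ℝ l (Y ω))) μ) (l v : Vec d) :
    DifferentiableAt ℝ
      (fun s : ℝ => Real.log (∫ ω, Real.exp (inner ℝ (l + s • v) (Y ω)) ∂μ)) 0 := by
  have hmgf : ∀ s : ℝ, ∫ ω, Real.exp (inner ℝ (l + s • v) (Y ω)) ∂μ
      = (∫ ω, Real.exp (inner ℝ l (Y ω)) ∂μ) *
        mgf (fun ω => inner ℝ v (Y ω)) (μ.tilted fun ω => inner ℝ l (Y ω)) s := by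
    intro s
    rw [mgf, integral_tilted, ← integral_const_mul]
    congr 1 with ω
    have := (integral_exp_pos (h l)).ne'
    rw [inner_add_left, inner_smul_left, Real.exp_add, smul_eq_mul]
    field_simp
    simp [mul_comm]
  have hset : integrableExpSet (fun ω => inner ℝ v (Y ω)) (μ.tilted fun ω => inner ℝ l (Y ω))
      = Set.univ := by
    refine Set.eq_univ_of_forall fun s => ?_
    change Integrable _ _
    rw [integrable_tilted_iff (h l)]
    refine (h (l + s • v)).congr (Eventually.of_forall fun ω => ?_)
    simp [inner_add_left, inner_smul_left, Real.exp_add]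
  simp only [hmgf]
  refine DifferentiableAt.log
    (DifferentiableAt.const_mul (differentiableAt_mgf (by simp [hset])) _) ?_
  rw [← hmgf]
  exact (integral_exp_pos (h _)).ne'

lemma hasDerivAt_log_integral_exp_inner_zero [IsProbabilityMeasure μ]
    (h : ∀ l, Integrable (fun ω => Real.exp (inner ℝ l (Y ω))) μ) (hYint : Integrable Y μ)
    (v : Vec d) :
    HasDerivAt (fun s : ℝ => Real.log (∫ ω, Real.exp (inner ℝ (s • v) (Y ω)) ∂μ))
      (inner ℝ v (∫ ω, Y ω ∂μ)) 0 := by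
  have hset : integrableExpSet (fun ω => inner ℝ v (Y ω)) μ = Set.univ := by
    refine Set.eq_univ_of_forall fun s => ?_
    change Integrable _ _
    simpa [inner_smul_left] using h (s • v)
  have h1 : (0 : ℝ) ∈ interior (integrableExpSet (fun ω => inner ℝ v (Y ω)) μ) := by simp [hset]
  have h2 := (analyticAt_cgf h1).differentiableAt.hasDerivAt
  rw [deriv_cgf_zero h1] at h2
  simp only [probReal_univ, div_one] at h2
  rw [← integral_inner hYint]
  refine h2.congr_of_eventuallyEq (Eventually.of_forall fun s => ?_)
  simp [cgf, mgf, inner_smul_left]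

lemma integrable_of_integrable_exp_inner [IsProbabilityMeasure μ]
    (h : ∀ l, Integrable (fun ω => Real.exp (inner ℝ l (Y ω))) μ) : Integrable Y μ := by
  have : ∀ k, Integrable (fun ω => (Y ω) k) μ := by
    intro k
    have hset : integrableExpSet (fun ω => (Y ω) k) μ = Set.univ := by
      refine Set.eq_univ_of_forall fun s => ?_
      change Integrable _ _
      simpa [EuclideanSpace.inner_single_left] using h (EuclideanSpace.single k s)
    exact integrable_of_mem_interior_integrableExpSet (by simp [hset])
  have hsum : Integrable (fun ω => ∑ k, (Y ω) k • EuclideanSpace.single k (1 : ℝ)) μ :=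
    integrable_finsetSum _ fun k _ => (this k).smul_const _
  refine hsum.congr (Eventually.of_forall fun ω => ?_)
  ext j
  simp [Finset.sum_apply, Pi.single_apply]

end LogMGF

/-! ### The states as weighted sums -/

section NodeState

variable {Ω : Type*} {N d : ℕ}

/-- The recursion unrolled. The index `p.2` runs over `0, …, t - 1`, and the observation that it stands for
is the one at time `p.2 + 1`. -/
lemma nodeState_const_eq (A : Matrix (Fin N) (Fin N) ℝ) (Z : Fin N → ℕ+ → Ω → Vec d)
    (i : Fin N) (t : ℕ) (ω : Ω) :
    (t : ℝ) • nodeState (fun _ _ => A) Z i t ω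
      = ∑ p ∈ Finset.univ ×ˢ Finset.range t, (A ^ (t - p.2)) i p.1 • Z p.1 p.2.succPNat ω := by
  rw [Finset.sum_product_right]
  induction t generalizing i with
  | zero => simp
  | succ t ih =>
    have ht : (t : ℝ) + 1 ≠ 0 := by positivity
    rw [nodeState, Finset.sum_range_succ, Nat.cast_add_one, Finset.smul_sum]
    have h1 : ∀ j, ((t : ℝ) + 1) • A i j • (((t : ℝ) / ((t : ℝ) + 1)) •
          nodeState (fun _ _ => A) Z j t ω + (1 / ((t : ℝ) + 1)) • Z j t.succPNat ω)
        = A i j • (t : ℝ) • nodeState (fun _ _ => A) Z j t ω + A i j • Z j t.succPNat ω := by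
      intro j
      rw [smul_comm, ← smul_add, smul_add ((t : ℝ) + 1), smul_smul, smul_smul,
        mul_div_cancel₀ _ ht, mul_one_div_cancel ht, one_smul]
    simp only [h1, Finset.sum_add_distrib, ih]
    congr 1
    · simp only [Finset.smul_sum]
      rw [Finset.sum_comm]
      refine Finset.sum_congr rfl fun s hs => ?_
      rw [Finset.sum_comm]
      refine Finset.sum_congr rfl fun k _ => ?_
      have hs' : t + 1 - s = (t - s) + 1 := by have := Finset.mem_range.1 hs; omega
      rw [hs', pow_succ', Matrix.mul_apply, Finset.sum_smul]
      simp only [smul_smul]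
    · simp

variable [MeasurableSpace Ω] {μ : Measure Ω} [IsProbabilityMeasure μ]

lemma measurable_nodeState (A : Matrix (Fin N) (Fin N) ℝ) {Z : Fin N → ℕ+ → Ω → Vec d}
    (hmeas : ∀ i t, Measurable (Z i t)) (i : Fin N) (t : ℕ) :
    Measurable (nodeState (fun _ _ => A) Z i t) := by
  induction t generalizing i with
  | zero => exact measurable_const
  | succ t ih =>
    unfold nodeState
    refine Finset.measurable_fun_sum _ fun j _ => ?_
    have := ih j
    have := hmeas j t.succPNat
    fun_prop

/-- If row `i` of `A ^ k` tends to `a`, then the scaled log-moment generating functions of `X_{i,t}` tend to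
`∑_j Λ_j(a_j l)`. -/
lemma hasScaledCGFLimit_nodeState {Z : Fin N → ℕ+ → Ω → Vec d}
    (hmeas : ∀ i t, Measurable (Z i t))
    (hindep : iIndepFun (fun p : Fin N × ℕ+ => Z p.1 p.2) μ)
    (hident : ∀ i s t, IdentDistrib (Z i s) (Z i t) μ μ)
    (hint : ∀ i t l, Integrable (fun ω => Real.exp (inner ℝ l (Z i t ω))) μ)
    (A : Matrix (Fin N) (Fin N) ℝ) (a : Fin N → ℝ) (i : Fin N)
    (hA : ∀ j, Tendsto (fun k => (A ^ k) i j) atTop (𝓝 (a j))) :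
    HasScaledCGFLimit μ (nodeState (fun _ _ => A) Z i)
      (fun l => ∑ j, Real.log (∫ ω, Real.exp (inner ℝ (a j • l) (Z j 1 ω)) ∂μ)) := by
  set W : Vec d → ℕ → Fin N × ℕ → Ω → ℝ := fun l t p ω =>
    (A ^ (t - p.2)) i p.1 * inner ℝ l (Z p.1 p.2.succPNat ω) with hW
  have hexp : ∀ (t : ℕ) (l : Vec d) ω, Real.exp (t * inner ℝ l (nodeState (fun _ _ => A) Z i t ω))
      = Real.exp (1 * (∑ p ∈ Finset.univ ×ˢ Finset.range t, W l t p) ω) := by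
    intro t l ω
    rw [← inner_smul_right, nodeState_const_eq, inner_sum, one_mul, Finset.sum_apply]
    simp [hW, inner_smul_right]
  have hWmeas : ∀ l t p, Measurable (W l t p) := fun l t p =>
    (measurable_const.inner (hmeas _ _)).const_mul _
  have hWint : ∀ l t p, Integrable (fun ω => Real.exp (1 * W l t p ω)) μ := by
    intro l t p
    simpa [hW, inner_smul_left] using hint p.1 p.2.succPNat ((A ^ (t - p.2)) i p.1 • l)
  have hWindep : ∀ l t, iIndepFun (W l t) μ := by
    intro l t
    have h1 : iIndepFun (fun p : Fin N × ℕ => Z p.1 p.2.succPNat) μ :=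
      hindep.precomp (g := fun p : Fin N × ℕ => (p.1, p.2.succPNat)) (by
        rintro ⟨i, s⟩ ⟨j, r⟩ h
        simpa [Prod.ext_iff] using h)
    exact h1.comp (fun p z => (A ^ (t - p.2)) i p.1 * inner ℝ l z) fun p =>
      (measurable_const.inner measurable_id).const_mul _
  refine ⟨measurable_nodeState A hmeas i, fun t l => ?_, fun l => ?_⟩
  · simp only [hexp]
    exact (hWindep l t).integrable_exp_mul_sum (hWmeas l t) fun p _ => hWint l t p
  · set f : ℕ → ℝ := fun k =>
      ∑ j, Real.log (∫ ω, Real.exp (inner ℝ ((A ^ (k + 1)) i j • l) (Z j 1 ω)) ∂μ) with hf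
    have hlim : Tendsto f atTop
        (𝓝 (∑ j, Real.log (∫ ω, Real.exp (inner ℝ (a j • l) (Z j 1 ω)) ∂μ))) := by
      refine tendsto_finsetSum _ fun j _ => ?_
      exact ((continuous_log_integral_exp_inner (hint j 1)).tendsto _).comp
        (((tendsto_add_atTop_iff_nat 1).2 (hA j)).smul_const l)
    refine hlim.cesaro.congr fun t => ?_
    rw [one_div]
    congr 1
    have hcgf := (hWindep l t).cgf_sum (t := 1) (hWmeas l t)
      (s := Finset.univ ×ˢ Finset.range t) fun p _ => hWint l t p
    have hleft : Real.log (∫ ω, Real.exp (t * inner ℝ l (nodeState (fun _ _ => A) Z i t ω)) ∂μ)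
        = cgf (∑ p ∈ Finset.univ ×ˢ Finset.range t, W l t p) μ 1 := by
      simp only [hexp]; rfl
    -- The observation at time `s + 1` carries the weight `A ^ (t - s)`; reversing time gives the Cesàro sum.
    rw [hleft, hcgf, Finset.sum_product_right, ← Finset.sum_range_reflect]
    refine Finset.sum_congr rfl fun s hs => ?_
    refine Finset.sum_congr rfl fun j _ => ?_
    have hs' : t - 1 - s + 1 = t - s := by have := Finset.mem_range.1 hs; omega
    have hid := ((hident j 1 s.succPNat).comp
      (u := fun z => Real.exp (inner ℝ ((A ^ (t - s)) i j • l) z)) (by fun_prop)).integral_eq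
    simp only [Function.comp_def] at hid
    rw [hs', hid, cgf, mgf]
    simp [hW, inner_smul_left]

end NodeState

theorem theorem2 {Ω : Type*} [MeasurableSpace Ω] (μ : Measure Ω) [IsProbabilityMeasure μ]
    {N d : ℕ} (Z : Fin N → ℕ+ → Ω → Vec d)
    (hmeas : ∀ i t, Measurable (Z i t))
    (hindep : iIndepFun (fun p : Fin N × ℕ+ => Z p.1 p.2) μ)
    (hident : ∀ i s t, IdentDistrib (Z i s) (Z i t) μ μ)
    (hfinite : ∀ i t l, logMGF μ (Z i t) l < ⊤)
    (A : Matrix (Fin N) (Fin N) ℝ) (hA : A ∈ Matrix.rowStochastic ℝ (Fin N))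
    (hlam : absLambdaTwo A < 1)
    (a : Fin N → ℝ) (ha : Matrix.vecMul a A = a) (ha1 : ∑ j, a j = 1) :
    (∀ i, SatisfiesLDP μ (nodeState (fun _ _ => A) Z i)
      (conjugate (fun l => ∑ j, logMGF μ (Z j 1) (a j • l)))) ∧
    (∀ i, ∀ᵐ ω ∂μ, Tendsto (fun t => nodeState (fun _ _ => A) Z i t ω) atTop
      (𝓝 (∑ j, a j • ∫ ω', Z j 1 ω' ∂μ))) := by
  have hint : ∀ i t l, Integrable (fun ω => Real.exp (inner ℝ l (Z i t ω))) μ := fun i t l =>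
    integrable_exp_inner_of_logMGF_lt_top (hmeas i t) l (hfinite i t l)
  have hpow := tendsto_pow_of_absLambdaTwo_lt_one A (Matrix.mem_rowStochastic.1 hA).2 hlam a ha ha1
  have hcgf := fun i => hasScaledCGFLimit_nodeState hmeas hindep hident hint A a i (hpow i)
  have hL : (fun l => ∑ j, logMGF μ (Z j 1) (a j • l)) = fun l =>
      ((∑ j, Real.log (∫ ω, Real.exp (inner ℝ (a j • l) (Z j 1 ω)) ∂μ) : ℝ) : EReal) := by
    ext1 l
    simp only [logMGF_eq_coe _ (hint _ _ _)]
    exact (map_sum (⟨⟨(↑), EReal.coe_zero⟩, EReal.coe_add⟩ : ℝ →+ EReal) _ _).symm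
  rw [hL]
  refine ⟨fun i => (hcgf i).satisfiesLDP ?_ ?_, fun i => (hcgf i).ae_tendsto fun v => ?_⟩
  · exact continuous_finsetSum _ fun j _ =>
      (continuous_log_integral_exp_inner (hint j 1)).comp (continuous_const_smul (a j))
  · intro l v
    refine DifferentiableAt.fun_sum fun j _ => ?_
    have := differentiableAt_log_integral_exp_inner (hint j 1) (a j • l) (a j • v)
    simpa only [smul_add, smul_comm (a j) _ v] using this
  · rw [inner_sum]
    refine HasDerivAt.fun_sum fun j _ => ?_
    have := hasDerivAt_log_integral_exp_inner_zero (hint j 1)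
      (integrable_of_integrable_exp_inner (hint j 1)) (a j • v)
    rw [inner_smul_left] at this
    rw [inner_smul_right]
    simpa only [smul_comm (a j) _ v, RCLike.conj_to_real] using this
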